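/- Let $n$ be a positive integer and let $f\colon\{0,1\}^n\to\{0,1\}$ be a Boolean function. A polynomial in $\mathbb{R}[X_1,\dots,X_n]$ is multilinear if every variable has exponent at most $1$ in each of its monomials. Define: - $D(f)$, the decision tree complexity of $f$: the minimum depth of a deterministic decision tree that queries bits of $x$ and outputs $f(x)$ at a leaf, for every $x\in\{0,1\}^n$; - $\mathrm{sdeg}(f)$, the sign degree of $f$: the minimum degree of a multilinear $p\in\mathbb{R}[X_1,\dots,X_n]$ such that, for all $x\in\{0,1\}^n$, $p(x)\neq 0$, and $p(x)<0$ if and only if $f(x)=1$; - $\mathrm{rdeg}(f)$, the rational degree of $f$: the minimum of $\max(\deg p,\deg q)$ over all multilinear $p,q\in\mathbb{R}[X_1,\dots,X_n]$ such that, for all $x\in\{0,1\}^n$, $q(x)\neq 0$ and $p(x)/q(x)=f(x)$. Then $$D(f)\le 4\,\mathrm{sdeg}(f)^2\,\mathrm{rdeg}(f)^2 .$$ -/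

import Mathlib

noncomputable section

namespace BoolFn

/-- The real number `0` or `1` that a bit stands for. -/
def bit (b : Bool) : ℝ := if b then 1 else 0

/-- The value of the real polynomial `p` at the point `x` of the cube `{0,1}ⁿ`. -/
def evalAt {n : ℕ} (p : MvPolynomial (Fin n) ℝ) (x : Fin n → Bool) : ℝ :=
  MvPolynomial.eval (fun i => bit (x i)) p

/-- `p` is multilinear: every variable has degree at most one in every monomial of `p`. -/
def IsMultilinear {n : ℕ} (p : MvPolynomial (Fin n) ℝ) : Prop :=
  p ∈ MvPolynomial.restrictDegree (Fin n) ℝ 1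

/-- The fraction `p / q` of multilinear polynomials is a rational representation of `f`. -/
def IsRationalRep {n : ℕ} (f : (Fin n → Bool) → Bool) (p q : MvPolynomial (Fin n) ℝ) : Prop :=
  IsMultilinear p ∧ IsMultilinear q ∧
    ∀ x, evalAt q x ≠ 0 ∧ evalAt p x / evalAt q x = bit (f x)

/-- The rational degree of `f`: the minimum of `max (deg p) (deg q)` over all rational
representations `p / q` of `f`. -/
def rdeg {n : ℕ} (f : (Fin n → Bool) → Bool) : ℕ :=
  sInf {d | ∃ p q, IsRationalRep f p q ∧ max p.totalDegree q.totalDegree = d}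

/-- The multilinear polynomial `p` is a sign representation of `f`. -/
def IsSignRep {n : ℕ} (f : (Fin n → Bool) → Bool) (p : MvPolynomial (Fin n) ℝ) : Prop :=
  IsMultilinear p ∧ ∀ x, evalAt p x ≠ 0 ∧ (evalAt p x < 0 ↔ f x = true)

/-- The sign degree of `f`: the minimum degree of a sign representation of `f`. -/
def sdeg {n : ℕ} (f : (Fin n → Bool) → Bool) : ℕ :=
  sInf {d | ∃ p, IsSignRep f p ∧ p.totalDegree = d}

/-- Deterministic decision trees on `n` input bits: a leaf carries an output bit, an inner node
queries bit `i` and continues in `t₀` or `t₁` according to the answer `0` or `1`. -/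
inductive DecisionTree (n : ℕ) : Type
  | leaf (b : Bool) : DecisionTree n
  | query (i : Fin n) (t₀ t₁ : DecisionTree n) : DecisionTree n

namespace DecisionTree

/-- The output of the tree on the input `x`. -/
def output {n : ℕ} : DecisionTree n → (Fin n → Bool) → Bool
  | leaf b, _ => b
  | query i t₀ t₁, x => if x i then t₁.output x else t₀.output x

/-- The depth of the tree: the maximum number of queries on a path from the root to a leaf. -/
def depth {n : ℕ} : DecisionTree n → ℕ
  | leaf _ => 0
  | query _ t₀ t₁ => max t₀.depth t₁.depth + 1

/-- The tree computes `f` exactly on every input. -/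
def Computes {n : ℕ} (T : DecisionTree n) (f : (Fin n → Bool) → Bool) : Prop :=
  ∀ x, T.output x = f x

end DecisionTree

/-- The decision tree complexity of `f`: the minimum depth of a decision tree computing `f`. -/
def D {n : ℕ} (f : (Fin n → Bool) → Bool) : ℕ :=
  sInf {d | ∃ T : DecisionTree n, T.Computes f ∧ T.depth = d}

/-! The three minima are taken over nonempty sets, hence are attained. -/

/-- Every real function on the cube is given by a multilinear polynomial. -/
theorem exists_multilinear {n : ℕ} (g : (Fin n → Bool) → ℝ) :
    ∃ p : MvPolynomial (Fin n) ℝ, IsMultilinear p ∧ ∀ x, evalAt p x = g x := by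
  classical
  have key : ∀ a : Fin n → Bool, ∃ p : MvPolynomial (Fin n) ℝ,
      IsMultilinear p ∧ ∀ x, evalAt p x = if x = a then 1 else 0 := by
    intro a
    refine ⟨∏ i, (if a i then MvPolynomial.X i else 1 - MvPolynomial.X i), ?_, ?_⟩
    · rw [IsMultilinear, MvPolynomial.mem_restrictDegree_iff_sup]
      intro j
      rw [← MvPolynomial.degreeOf_def]
      refine (MvPolynomial.degreeOf_prod_le j _ _).trans ?_
      have hb : ∀ i ∈ (Finset.univ : Finset (Fin n)), MvPolynomial.degreeOf j
          (if a i then MvPolynomial.X i else 1 - MvPolynomial.X i : MvPolynomial (Fin n) ℝ)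
            ≤ if j = i then 1 else 0 := by
        intro i _
        have hX : MvPolynomial.degreeOf j (MvPolynomial.X i : MvPolynomial (Fin n) ℝ)
            ≤ if j = i then 1 else 0 := (MvPolynomial.degreeOf_X (R := ℝ) j i).le
        by_cases h : a i = true
        · simpa [h] using hX
        · simp only [h]
          refine (MvPolynomial.degreeOf_sub_le j _ _).trans (max_le ?_ hX)
          simp [MvPolynomial.degreeOf_one]
      refine (Finset.sum_le_sum hb).trans ?_
      simp
    · intro x
      have hx : evalAt (∏ i, (if a i then MvPolynomial.X i else 1 - MvPolynomial.X i)) x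
          = ∏ i, (if x i = a i then (1 : ℝ) else 0) := by
        rw [evalAt, map_prod]
        refine Finset.prod_congr rfl fun i _ => ?_
        cases h : a i <;> cases h' : x i <;> simp [bit, h']
      rw [hx]
      by_cases h : x = a
      · simp [h]
      · obtain ⟨i, hi⟩ := Function.ne_iff.mp h
        rw [if_neg h]
        exact Finset.prod_eq_zero (Finset.mem_univ i) (if_neg hi)
  choose P hP hP' using key
  refine ⟨∑ a, MvPolynomial.C (g a) * P a, ?_, ?_⟩
  · refine Submodule.sum_mem _ fun a _ => ?_
    rw [← MvPolynomial.smul_eq_C_mul]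
    exact Submodule.smul_mem _ _ (hP a)
  · intro x
    have h : ∀ a, MvPolynomial.eval (fun i => bit (x i)) (P a) = if x = a then 1 else 0 :=
      fun a => hP' a x
    simp [evalAt, map_sum, h]

theorem exists_rdeg {n : ℕ} (f : (Fin n → Bool) → Bool) :
    ∃ p q, IsRationalRep f p q ∧ max p.totalDegree q.totalDegree = rdeg f := by
  obtain ⟨p, hp, hp'⟩ := exists_multilinear fun x => bit (f x)
  obtain ⟨q, hq, hq'⟩ := exists_multilinear fun _ : Fin n → Bool => (1 : ℝ)
  exact Nat.sInf_mem (s := {d | ∃ p q, IsRationalRep f p q ∧ max p.totalDegree q.totalDegree = d})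
    ⟨_, p, q, ⟨hp, hq, fun x => by simp [hp', hq']⟩, rfl⟩

theorem exists_sdeg {n : ℕ} (f : (Fin n → Bool) → Bool) :
    ∃ p, IsSignRep f p ∧ p.totalDegree = sdeg f := by
  obtain ⟨p, hp, hp'⟩ := exists_multilinear fun x => if f x then (-1 : ℝ) else 1
  refine Nat.sInf_mem (s := {d | ∃ p, IsSignRep f p ∧ p.totalDegree = d})
    ⟨_, p, ⟨hp, fun x => ?_⟩, rfl⟩
  rw [hp']
  cases f x <;> norm_num

theorem exists_D {n : ℕ} (f : (Fin n → Bool) → Bool) :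
    ∃ T : DecisionTree n, T.Computes f ∧ T.depth = D f := by
  classical
  have key : ∀ l : List (Fin n), ∀ g : (Fin n → Bool) → Bool,
      (∀ x y, (∀ i ∈ l, x i = y i) → g x = g y) → ∃ T : DecisionTree n, T.Computes g := by
    intro l
    induction l with
    | nil => exact fun g hg => ⟨.leaf (g fun _ => false), fun x => hg _ _ (by simp)⟩
    | cons i l ih =>
      intro g hg
      have hb : ∀ b, ∃ T : DecisionTree n, T.Computes fun x => g (Function.update x i b) := by
        intro b
        refine ih _ fun x y hxy => hg _ _ fun j hj => ?_
        by_cases hji : j = i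
        · subst hji
          simp
        · simpa [hji] using hxy j (by simpa [hji] using hj)
      obtain ⟨T₀, h₀⟩ := hb false
      obtain ⟨T₁, h₁⟩ := hb true
      refine ⟨.query i T₀ T₁, fun x => ?_⟩
      have hu : ∀ b, x i = b → Function.update x i b = x := by
        rintro _ rfl
        exact Function.update_eq_self i x
      cases hx : x i
      · simp [DecisionTree.output, hx, h₀ x, hu _ hx]
      · simp [DecisionTree.output, hx, h₁ x, hu _ hx]
  obtain ⟨T, hT⟩ := key (List.finRange n) f fun x y h => congrArg f (funext fun i => h i (by simp))
  exact Nat.sInf_mem (s := {d | ∃ T : DecisionTree n, T.Computes f ∧ T.depth = d}) ⟨_, T, hT, rfl⟩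

end BoolFn

end

/-!
A fraction `p / q` representing `f` yields two polynomials, `p` and `q - p`, that are nonzero
exactly where `f` is `1` and where `f` is `0`. Let `s` be a sign representation of `f`, let `x`
maximize `|s|`, and let `r` be the one of the two polynomials that is nonzero exactly where `f`
differs from `f x`. Every monomial `B` of top degree of `r` gives a point that agrees with `x` off
`B` and at which `r` does not vanish, so that `s` has changed its sign there. Given `m` such
points for disjoint monomials, move `x` to each of them on its own block independently with
probability `t`: the mean of `s` is a polynomial in `t` of degree at most `deg s`, is bounded by
`|s x|` on `[0, 1]`, and changes at `t = 0` at rate at least `m |s x|`. Markov's inequality gives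
`m ≤ 2 (deg s)²`. Hence querying all variables of a maximal disjoint family of top monomials costs
at most `2 (deg s)² deg r` queries, and it lowers the degree of `r` because every top monomial
meets the family. Repeat until one of the two polynomials is constant.
-/

namespace BoolFn

open Finset
open scoped Polynomial

/-! ### Functions of bounded degree on the cube -/

section CubeDegree

variable {ι κ : Type*}

/-- The function `x ↦ ∏ i ∈ B, x i` on the cube, the value of a multilinear monomial. -/
def cubeMonomial (B : Finset ι) (x : ι → Bool) : ℝ := ∏ i ∈ B, bit (x i)

variable (ι) in
/-- The real functions of degree at most `d` on the cube. As `bit b ^ 2 = bit b`, multilinear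
monomials suffice to span them. -/
def cubeDegreeLE (d : ℕ) : Submodule ℝ ((ι → Bool) → ℝ) :=
  Submodule.span ℝ (cubeMonomial '' {B | #B ≤ d})

theorem cubeMonomial_mem_cubeDegreeLE {d : ℕ} {B : Finset ι} (hB : #B ≤ d) :
    cubeMonomial B ∈ cubeDegreeLE ι d :=
  Submodule.subset_span ⟨B, hB, rfl⟩

theorem cubeDegreeLE_mono {d e : ℕ} (h : d ≤ e) : cubeDegreeLE ι d ≤ cubeDegreeLE ι e :=
  Submodule.span_mono (Set.image_mono fun _ hB => le_trans hB h)

theorem const_mem_cubeDegreeLE (d : ℕ) (c : ℝ) : (fun _ => c) ∈ cubeDegreeLE ι d := by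
  have h : (fun _ => c) = c • cubeMonomial (∅ : Finset ι) := by
    funext x
    simp [cubeMonomial]
  exact h ▸ Submodule.smul_mem _ _ (cubeMonomial_mem_cubeDegreeLE d.zero_le)

theorem bit_apply_mem_cubeDegreeLE (i : ι) : (fun x => bit (x i)) ∈ cubeDegreeLE ι 1 := by
  have h : (fun x => bit (x i)) = cubeMonomial {i} := by
    funext x
    simp [cubeMonomial]
  exact h ▸ cubeMonomial_mem_cubeDegreeLE (card_singleton i).le

theorem bit_mul_self (b : Bool) : bit b * bit b = bit b := by
  cases b <;> simp [bit]

theorem cubeMonomial_mul [DecidableEq ι] (B C : Finset ι) :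
    cubeMonomial B * cubeMonomial C = cubeMonomial (B ∪ C) := by
  funext x
  rw [Pi.mul_apply, cubeMonomial, cubeMonomial, cubeMonomial, ← prod_union_inter,
    ← sdiff_union_inter (B ∪ C) (B ∩ C), prod_union (disjoint_sdiff_inter _ _), mul_assoc,
    inter_eq_right.mpr (inter_subset_union), ← prod_mul_distrib]
  simp only [bit_mul_self]

theorem mul_mem_cubeDegreeLE {d e : ℕ} {g h : (ι → Bool) → ℝ} (hg : g ∈ cubeDegreeLE ι d)
    (hh : h ∈ cubeDegreeLE ι e) : g * h ∈ cubeDegreeLE ι (d + e) := by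
  classical
  suffices cubeDegreeLE ι d * cubeDegreeLE ι e ≤ cubeDegreeLE ι (d + e) from
    this (Submodule.mul_mem_mul hg hh)
  rw [cubeDegreeLE, cubeDegreeLE, Submodule.span_mul_span, Submodule.span_le]
  rintro _ ⟨_, ⟨B, hB, rfl⟩, _, ⟨C, hC, rfl⟩, rfl⟩
  simp only [cubeMonomial_mul]
  exact cubeMonomial_mem_cubeDegreeLE ((card_union_le B C).trans (add_le_add hB hC))

theorem comp_mem_cubeDegreeLE {d : ℕ} {g : (ι → Bool) → ℝ} (hg : g ∈ cubeDegreeLE ι d)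
    {φ : (κ → Bool) → ι → Bool} (hφ : ∀ i, (fun z => bit (φ z i)) ∈ cubeDegreeLE κ 1) :
    g ∘ φ ∈ cubeDegreeLE κ d := by
  classical
  have hmonomial : ∀ B : Finset ι, cubeMonomial B ∘ φ ∈ cubeDegreeLE κ #B := by
    intro B
    induction B using Finset.induction_on with
    | empty => simpa [cubeMonomial, Function.comp_def] using const_mem_cubeDegreeLE 0 1
    | insert i B hi ih =>
      have h : cubeMonomial (insert i B) ∘ φ = (cubeMonomial B ∘ φ) * fun z => bit (φ z i) := by
        funext z
        simp [cubeMonomial, prod_insert hi, mul_comm]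
      rw [h, card_insert_of_notMem hi]
      exact mul_mem_cubeDegreeLE ih (hφ i)
  suffices cubeDegreeLE ι d ≤ (cubeDegreeLE κ d).comap (LinearMap.funLeft ℝ ℝ φ) from this hg
  refine Submodule.span_le.mpr ?_
  rintro _ ⟨B, hB, rfl⟩
  exact cubeDegreeLE_mono hB (hmonomial B)

theorem comp_piecewise_mem_cubeDegreeLE [DecidableEq ι] {d : ℕ} {g : (ι → Bool) → ℝ}
    (hg : g ∈ cubeDegreeLE ι d) (Q : Finset ι) (ρ : ι → Bool) :
    (fun x => g (Q.piecewise ρ x)) ∈ cubeDegreeLE ι d := by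
  refine comp_mem_cubeDegreeLE hg fun i => ?_
  by_cases hi : i ∈ Q
  · simpa only [piecewise_eq_of_mem _ _ _ hi] using const_mem_cubeDegreeLE 1 _
  · simpa only [piecewise_eq_of_notMem _ _ _ hi] using bit_apply_mem_cubeDegreeLE i

theorem eq_of_mem_cubeDegreeLE_zero {g : (ι → Bool) → ℝ} (hg : g ∈ cubeDegreeLE ι 0)
    (x y : ι → Bool) : g x = g y := by
  have h : cubeDegreeLE ι 0 ≤
      LinearMap.eqLocus (LinearMap.proj x) (LinearMap.proj (R := ℝ) (φ := fun _ => ℝ) y) := by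
    refine Submodule.span_le.mpr ?_
    rintro _ ⟨B, hB, rfl⟩
    obtain rfl : B = ∅ := by simpa using hB
    simp [cubeMonomial]
  exact h hg

theorem exists_coeff_of_mem_cubeDegreeLE [Fintype ι] {d : ℕ} {g : (ι → Bool) → ℝ}
    (hg : g ∈ cubeDegreeLE ι d) :
    ∃ c : Finset ι → ℝ, (∀ B, c B ≠ 0 → #B ≤ d) ∧ g = ∑ B, c B • cubeMonomial B := by
  have hfilter : {B : Finset ι | #B ≤ d} = ↑(univ.filter fun B : Finset ι => #B ≤ d) := by simp
  rw [cubeDegreeLE, hfilter, Submodule.mem_span_image_finset_iff_exists_fun'] at hg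
  obtain ⟨c, rfl⟩ := hg
  refine ⟨fun B => if #B ≤ d then c B else 0, fun B hB => of_not_not fun h => hB (if_neg h), ?_⟩
  rw [sum_filter]
  simp only [ite_smul, zero_smul]

theorem evalAt_mem_cubeDegreeLE {n : ℕ} (p : MvPolynomial (Fin n) ℝ) :
    evalAt p ∈ cubeDegreeLE (Fin n) p.totalDegree := by
  have hp : evalAt p = ∑ m ∈ p.support, p.coeff m • cubeMonomial m.support := by
    funext x
    simp only [evalAt, MvPolynomial.eval_eq, Finset.sum_apply, Pi.smul_apply, smul_eq_mul,
      cubeMonomial]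
    refine sum_congr rfl fun m _ => congrArg _ (prod_congr rfl fun i hi => ?_)
    have hmi : m i ≠ 0 := Finsupp.mem_support_iff.mp hi
    cases x i <;> simp [bit, hmi]
  have hcard : ∀ m : Fin n →₀ ℕ, #m.support ≤ m.sum fun _ e => e := fun m => by
    rw [Finsupp.sum, card_eq_sum_ones]
    exact sum_le_sum fun i hi => Nat.one_le_iff_ne_zero.mpr (Finsupp.mem_support_iff.mp hi)
  rw [hp]
  exact Submodule.sum_mem _ fun m hm => Submodule.smul_mem _ _ <|
    cubeMonomial_mem_cubeDegreeLE ((hcard m).trans (MvPolynomial.le_totalDegree hm))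

end CubeDegree

/-! ### Monomials as a basis, and restriction to subcubes -/

section Monomials

variable {ι : Type*} [DecidableEq ι]

/-- The vertex of the cube with support `T`. -/
def vertex (T : Finset ι) (i : ι) : Bool := decide (i ∈ T)

theorem cubeMonomial_vertex (B T : Finset ι) :
    cubeMonomial B (vertex T) = if B ⊆ T then 1 else 0 := by
  simp only [cubeMonomial, bit, vertex, decide_eq_true_eq, prod_ite_zero, prod_const_one]
  rfl

theorem cubeMonomial_piecewise (B Q : Finset ι) (ρ x : ι → Bool) :
    cubeMonomial B (Q.piecewise ρ x) = cubeMonomial (B ∩ Q) ρ * cubeMonomial (B \ Q) x := by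
  rw [cubeMonomial, ← prod_inter_mul_prod_sdiff B Q]
  refine congrArg₂ _ (prod_congr rfl fun i hi => ?_) (prod_congr rfl fun i hi => ?_)
  · rw [piecewise_eq_of_mem _ _ _ (mem_inter.mp hi).2]
  · rw [piecewise_eq_of_notMem _ _ _ (mem_sdiff.mp hi).2]

theorem linearIndependent_cubeMonomial {ι : Type*} :
    LinearIndependent ℝ (cubeMonomial : Finset ι → (ι → Bool) → ℝ) := by
  classical
  rw [linearIndependent_iff']
  intro S c hc T
  induction T using Finset.strongInduction with
  | H T ih =>
    intro hT
    have hother : ∀ B ∈ S, B ≠ T → c B * cubeMonomial B (vertex T) = 0 := by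
      intro B hB hne
      rw [cubeMonomial_vertex]
      by_cases hBT : B ⊆ T
      · rw [ih B (hBT.ssubset_of_ne hne) hB, zero_mul]
      · rw [if_neg hBT, mul_zero]
    have heval := congrFun hc (vertex T)
    simp only [Finset.sum_apply, Pi.smul_apply, smul_eq_mul, Pi.zero_apply] at heval
    rw [sum_eq_single_of_mem T hT hother] at heval
    simpa [cubeMonomial_vertex] using heval

theorem span_range_cubeMonomial {ι : Type*} [Finite ι] :
    Submodule.span ℝ (Set.range (cubeMonomial : Finset ι → (ι → Bool) → ℝ)) = ⊤ := by
  classical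
  have := Fintype.ofFinite ι
  exact linearIndependent_cubeMonomial.span_eq_top_of_card_eq_finrank' (by simp)

/-- On the subcube of the points that agree with `x` off `A`, the coefficient of `cubeMonomial A`
is still `c A`, since no other monomial contains `A`. -/
theorem exists_ne_zero_of_maximal_coeff {ι : Type*} [Fintype ι] {c : Finset ι → ℝ} {A : Finset ι}
    (hA : Maximal (c · ≠ 0) A) (x : ι → Bool) :
    ∃ y : ι → Bool, (∀ i, y i ≠ x i → i ∈ A) ∧ (∑ B, c B • cubeMonomial B) y ≠ 0 := by
  classical
  by_contra! hzero
  let a (T : Finset ι) : ℝ := ∑ B with B ∩ A = T, c B * cubeMonomial (B \ A) x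
  have hsum : ∑ T, a T • cubeMonomial T = 0 := by
    funext z
    have hpoint := hzero (A.piecewise z x) fun i hi => of_not_not fun hiA =>
      hi (piecewise_eq_of_notMem _ _ _ hiA)
    simp only [Finset.sum_apply, Pi.smul_apply, smul_eq_mul, cubeMonomial_piecewise] at hpoint
    rw [Pi.zero_apply, ← hpoint, ← sum_fiberwise univ (· ∩ A)
      (fun B => c B * (cubeMonomial (B ∩ A) z * cubeMonomial (B \ A) x))]
    simp only [Finset.sum_apply, Pi.smul_apply, smul_eq_mul, a, sum_mul]
    refine sum_congr rfl fun T _ => sum_congr rfl fun B hB => ?_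
    rw [(mem_filter.mp hB).2]
    ring
  have haA : a A = c A := by
    refine (sum_eq_single_of_mem A (by simp) fun B hB hne => ?_).trans (by simp [cubeMonomial])
    have hAB : A ⊆ B := inter_eq_right.mp (mem_filter.mp hB).2
    have hcB : c B = 0 := of_not_not fun h => hne (hA.eq_of_ge h hAB)
    rw [hcB, zero_mul]
  exact hA.prop (haA ▸ Fintype.linearIndependent_iff.mp linearIndependent_cubeMonomial a hsum A)

theorem sum_comp_piecewise_mem_cubeDegreeLE [Fintype ι] {d : ℕ} {c : Finset ι → ℝ} {Q : Finset ι}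
    (h : ∀ B, c B ≠ 0 → #(B \ Q) ≤ d) (ρ : ι → Bool) :
    (fun x => (∑ B, c B • cubeMonomial B) (Q.piecewise ρ x)) ∈ cubeDegreeLE ι d := by
  have hexpand : (fun x => (∑ B, c B • cubeMonomial B) (Q.piecewise ρ x))
      = ∑ B, (c B * cubeMonomial (B ∩ Q) ρ) • cubeMonomial (B \ Q) := by
    funext x
    simp [Finset.sum_apply, cubeMonomial_piecewise, mul_assoc]
  rw [hexpand]
  refine Submodule.sum_mem _ fun B _ => ?_
  by_cases hB : c B = 0
  · simp [hB]
  · exact Submodule.smul_mem _ _ (cubeMonomial_mem_cubeDegreeLE (h B hB))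

end Monomials

/-! ### The mean over a biased random vertex -/

section BiasedMean

variable {κ : Type*} [Fintype κ] [DecidableEq κ]

/-- The mean of `g` over a random vertex of the cube whose coordinates are independently `1` with
probability `t`, as a polynomial in `t`. -/
noncomputable def biasedMean : ((κ → Bool) → ℝ) →ₗ[ℝ] ℝ[X] :=
  Fintype.linearCombination ℝ fun z => ∏ k, if z k then Polynomial.X else 1 - Polynomial.X

theorem biasedMean_cubeMonomial (B : Finset κ) :
    biasedMean (cubeMonomial B) = Polynomial.X ^ #B := by
  let w (k : κ) (b : Bool) : ℝ[X] :=
    (if k ∈ B then Polynomial.C (bit b) else 1) * if b then Polynomial.X else 1 - Polynomial.X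
  have hz : ∀ z : κ → Bool, (cubeMonomial B z) • (∏ k, if z k then (Polynomial.X : ℝ[X])
      else 1 - Polynomial.X) = ∏ k, w k (z k) := by
    intro z
    simp only [w, prod_mul_distrib, prod_ite_mem, univ_inter, cubeMonomial, ← map_prod,
      Polynomial.smul_eq_C_mul]
  have hw : ∀ k, ∑ b, w k b = if k ∈ B then Polynomial.X else 1 := by
    intro k
    by_cases hk : k ∈ B <;> simp [w, hk, bit]
  rw [biasedMean, Fintype.linearCombination_apply, sum_congr rfl fun z _ => hz z,
    ← Fintype.prod_sum, prod_congr rfl fun k _ => hw k]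
  simp

theorem natDegree_biasedMean_le {d : ℕ} {g : (κ → Bool) → ℝ} (hg : g ∈ cubeDegreeLE κ d) :
    (biasedMean g).natDegree ≤ d := by
  suffices cubeDegreeLE κ d ≤ (Polynomial.degreeLE ℝ d).comap biasedMean from
    Polynomial.natDegree_le_of_degree_le (Polynomial.mem_degreeLE.mp (this hg))
  refine Submodule.span_le.mpr ?_
  rintro _ ⟨B, hB, rfl⟩
  rw [SetLike.mem_coe, Submodule.mem_comap, biasedMean_cubeMonomial, Polynomial.mem_degreeLE]
  exact (Polynomial.degree_X_pow_le _).trans (mod_cast hB)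

theorem abs_eval_biasedMean_le {g : (κ → Bool) → ℝ} {M : ℝ} (hg : ∀ z, |g z| ≤ M) {t : ℝ}
    (ht : t ∈ Set.Icc (0 : ℝ) 1) : |(biasedMean g).eval t| ≤ M := by
  let weight (z : κ → Bool) : ℝ := ∏ k, if z k then t else 1 - t
  have heval : ∀ h : (κ → Bool) → ℝ, (biasedMean h).eval t = ∑ z, h z * weight z := by
    intro h
    simp [biasedMean, Fintype.linearCombination_apply, Polynomial.eval_finsetSum,
      Polynomial.eval_prod, weight, apply_ite (Polynomial.eval t)]
  have hnonneg : ∀ z, 0 ≤ weight z := fun z => prod_nonneg fun k _ => by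
    split_ifs
    · exact ht.1
    · exact sub_nonneg.mpr ht.2
  have htotal : ∑ z, weight z = 1 := by
    simpa [cubeMonomial, biasedMean_cubeMonomial] using (heval (cubeMonomial ∅)).symm
  calc |(biasedMean g).eval t|
      = |∑ z, g z * weight z| := by rw [heval]
    _ ≤ ∑ z, |g z * weight z| := abs_sum_le_sum_abs _ _
    _ ≤ ∑ z, M * weight z := sum_le_sum fun z _ => by
        rw [abs_mul, abs_of_nonneg (hnonneg z)]
        exact mul_le_mul_of_nonneg_right (hg z) (hnonneg z)
    _ = M := by rw [← mul_sum, htotal, mul_one]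

theorem eval_zero_derivative_biasedMean (g : (κ → Bool) → ℝ) :
    (biasedMean g).derivative.eval 0 = ∑ k, (g (vertex {k}) - g (vertex ∅)) := by
  have hg : g ∈ Submodule.span ℝ (Set.range cubeMonomial) := by simp [span_range_cubeMonomial]
  induction hg using Submodule.span_induction with
  | zero => simp
  | add g h _ _ ihg ihh =>
    simp only [map_add, Polynomial.eval_add, ihg, ihh, Pi.add_apply, ← sum_add_distrib]
    exact sum_congr rfl fun k _ => by ring
  | smul c g _ ih =>
    simp only [map_smul, Polynomial.eval_smul, ih, smul_eq_mul,
      mul_sum, Pi.smul_apply, mul_sub]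
  | mem g hg =>
    obtain ⟨B, rfl⟩ := hg
    simp only [biasedMean_cubeMonomial, cubeMonomial_vertex, subset_empty, subset_singleton_iff]
    rcases B.eq_empty_or_nonempty with rfl | hB
    · simp
    by_cases hcard : #B = 1
    · obtain ⟨i, rfl⟩ := card_eq_one.mp hcard
      simp
    · have hne : ∀ k, B ≠ {k} := fun k hk => hcard (hk ▸ card_singleton k)
      have hpred : #B - 1 ≠ 0 := by have := hB.card_pos; omega
      simp [hB.ne_empty, hne, hpred, Polynomial.derivative_X_pow]

end BiasedMean

section Markov

open Polynomial

/-- Markov's inequality at an endpoint of `[0, 1]`. The affine map `t ↦ (1 - t) / 2` reduces it to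
the extremality of the Chebyshev polynomials at the endpoint `1` of `[-1, 1]`. -/
theorem neg_eval_zero_derivative_le {d : ℕ} {r : ℝ[X]} (hd : r.natDegree ≤ d) {M : ℝ} (hM : 0 < M)
    (hr : ∀ t ∈ Set.Icc (0 : ℝ) 1, |r.eval t| ≤ M) :
    -r.derivative.eval 0 ≤ 2 * d ^ 2 * M := by
  let P : ℝ[X] := C M⁻¹ * r.comp (C (1 / 2) * (1 - X))
  have hdeg : P.degree ≤ d := by
    have hlin : (C (1 / 2) * (1 - X) : ℝ[X]).natDegree ≤ 1 := by compute_degree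
    refine degree_le_of_natDegree_le ((natDegree_C_mul_le _ _).trans (natDegree_comp_le.trans ?_))
    simpa using Nat.mul_le_mul hd hlin
  have hbound : ∀ u ∈ Set.Icc (-1 : ℝ) 1, |P.eval u| ≤ 1 := by
    intro u hu
    have h := hr (1 / 2 * (1 - u)) ⟨by linarith [hu.2], by linarith [hu.1]⟩
    simp only [P, eval_mul, eval_C, eval_comp, eval_sub, eval_one, eval_X, abs_mul]
    rw [abs_of_pos (inv_pos.mpr hM)]
    exact (inv_mul_le_one₀ hM).mpr h
  have hderiv : P.derivative.eval 1 = M⁻¹ * (-(1 / 2) * r.derivative.eval 0) := by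
    simp [P, derivative_comp]
  have hT : (Chebyshev.T ℝ d).derivative.eval 1 = (d : ℝ) ^ 2 := by
    simp [Chebyshev.T_derivative_eq_U, sq]
  have hmarkov : P.derivative.eval 1 ≤ (Chebyshev.T ℝ d).derivative.eval 1 :=
    Chebyshev.eval_iterate_derivative_le_of_forall_abs_le_one (k := 1) le_rfl hdeg hbound
  rw [hderiv, hT, inv_mul_le_iff₀ hM] at hmarkov
  linarith

end Markov

/-! ### Disjoint blocks flipping the sign of a function -/

section Blocks

variable {ι κ : Type*} [Fintype κ]

/-- The point `x` after moving to `y k`, for every `k` with `z k = 1`, on the coordinates where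
`y k` differs from `x`. -/
def flipBlocks (x : ι → Bool) (y : κ → ι → Bool) (z : κ → Bool) (i : ι) : Bool :=
  x i ^^ decide (∃ k, z k = true ∧ y k i ≠ x i)

variable (x : ι → Bool) (y : κ → ι → Bool)

theorem flipBlocks_vertex_empty [DecidableEq κ] : flipBlocks x y (vertex ∅) = x := by
  funext i
  simp [flipBlocks, vertex]

theorem flipBlocks_vertex_singleton [DecidableEq κ] (k : κ) :
    flipBlocks x y (vertex {k}) = y k := by
  funext i
  cases hx : x i <;> cases hy : y k i <;> simp [flipBlocks, vertex, hx, hy]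

variable {x y}

theorem bit_flipBlocks (hdisj : ∀ i j k, y j i ≠ x i → y k i ≠ x i → j = k) (z : κ → Bool)
    (i : ι) :
    bit (flipBlocks x y z i) = bit (x i) + ∑ k, (bit (y k i) - bit (x i)) * bit (z k) := by
  by_cases h : ∃ k, y k i ≠ x i
  · obtain ⟨k, hk⟩ := h
    have hother : ∀ j, j ≠ k → y j i = x i := fun j hj => of_not_not fun h => hj (hdisj i j k h hk)
    have hexists : (∃ j, z j = true ∧ y j i ≠ x i) ↔ z k = true :=
      ⟨fun ⟨j, hzj, hj⟩ => hdisj i j k hj hk ▸ hzj, fun hz => ⟨k, hz, hk⟩⟩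
    rw [Fintype.sum_eq_single k fun j hj => by simp [hother j hj], flipBlocks]
    simp only [hexists]
    cases hx : x i <;> cases hy : y k i <;> cases hz : z k <;> simp_all [bit]
  · push Not at h
    simp [flipBlocks, h]

theorem comp_flipBlocks_mem_cubeDegreeLE
    (hdisj : ∀ i j k, y j i ≠ x i → y k i ≠ x i → j = k) {d : ℕ} {s : (ι → Bool) → ℝ}
    (hs : s ∈ cubeDegreeLE ι d) : s ∘ flipBlocks x y ∈ cubeDegreeLE κ d := by
  refine comp_mem_cubeDegreeLE hs fun i => ?_
  have h : (fun z => bit (flipBlocks x y z i)) =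
      (fun _ => bit (x i)) + ∑ k, (bit (y k i) - bit (x i)) • fun z : κ → Bool => bit (z k) := by
    funext z
    simp [bit_flipBlocks hdisj z i, Finset.sum_apply]
  rw [h]
  exact Submodule.add_mem _ (const_mem_cubeDegreeLE 1 _) <| Submodule.sum_mem _ fun k _ =>
    Submodule.smul_mem _ _ (bit_apply_mem_cubeDegreeLE k)

theorem card_le_two_mul_sq_of_isMax (hdisj : ∀ i j k, y j i ≠ x i → y k i ≠ x i → j = k) {d : ℕ}
    {s : (ι → Bool) → ℝ} (hs : s ∈ cubeDegreeLE ι d) (hmax : ∀ z, |s z| ≤ |s x|) (hx : s x ≠ 0)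
    (hy : ∀ k, s x * s (y k) ≤ 0) : Fintype.card κ ≤ 2 * d ^ 2 := by
  classical
  let g : (κ → Bool) → ℝ := s x • (s ∘ flipBlocks x y)
  have hsq : 0 < s x * s x := mul_self_pos.mpr hx
  have hdeg : (biasedMean g).natDegree ≤ d :=
    natDegree_biasedMean_le (Submodule.smul_mem _ _ (comp_flipBlocks_mem_cubeDegreeLE hdisj hs))
  have hbound : ∀ z, |g z| ≤ s x * s x := fun z => by
    rw [← abs_mul_abs_self (s x)]
    simpa [g, abs_mul] using mul_le_mul_of_nonneg_left (hmax _) (abs_nonneg (s x))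
  have hslope : (biasedMean g).derivative.eval 0 ≤ -(Fintype.card κ * (s x * s x)) := by
    rw [eval_zero_derivative_biasedMean]
    refine (sum_le_card_nsmul univ _ (-(s x * s x)) fun k _ => ?_).trans_eq ?_
    · simpa [g, flipBlocks_vertex_singleton, flipBlocks_vertex_empty] using hy k
    · simp
  have hmarkov := neg_eval_zero_derivative_le hdeg hsq fun t ht => abs_eval_biasedMean_le hbound ht
  have h : (Fintype.card κ : ℝ) * (s x * s x) ≤ 2 * d ^ 2 * (s x * s x) := by linarith
  exact_mod_cast le_of_mul_le_mul_right h hsq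

end Blocks

/-! ### Lowering the degree by a few queries -/

theorem exists_pairwiseDisjoint_subset_forall_not_disjoint {α : Type*} [DecidableEq α]
    (G : Finset (Finset α)) :
    ∃ F ⊆ G, (F : Set (Finset α)).PairwiseDisjoint id ∧
      ∀ B ∈ G, B.Nonempty → ¬Disjoint B (F.biUnion id) := by
  have hfinite : {F | F ⊆ G ∧ (F : Set (Finset α)).PairwiseDisjoint id}.Finite :=
    G.powerset.finite_toSet.subset fun F hF => mem_powerset.mpr hF.1
  obtain ⟨F, hF⟩ := hfinite.exists_maximal ⟨∅, by simp⟩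
  refine ⟨F, hF.prop.1, hF.prop.2, fun B hB hne hdisj => hne.ne_empty ?_⟩
  have hinsert : insert B F ⊆ G ∧ (insert B F : Set (Finset α)).PairwiseDisjoint id :=
    ⟨insert_subset hB hF.prop.1, hF.prop.2.insert fun A hA _ =>
      disjoint_of_subset_right (subset_biUnion_of_mem id hA) hdisj⟩
  have hBF : B ∈ F :=
    hF.le_of_ge (by simpa using hinsert) (subset_insert B F) (mem_insert_self B F)
  exact disjoint_self_iff_empty B |>.mp
    (disjoint_of_subset_right (subset_biUnion_of_mem id hBF) hdisj)

theorem card_le_of_pairwiseDisjoint_top_monomials {ι : Type*} [Fintype ι] {d : ℕ}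
    {s : (ι → Bool) → ℝ} (hs : s ∈ cubeDegreeLE ι d) {x : ι → Bool} (hmax : ∀ z, |s z| ≤ |s x|)
    (hx : s x ≠ 0) {c : Finset ι → ℝ}
    (hsign : ∀ z, (∑ B, c B • cubeMonomial B) z ≠ 0 → s x * s z ≤ 0) {F : Finset (Finset ι)}
    (hF : (F : Set (Finset ι)).PairwiseDisjoint id) (htop : ∀ A ∈ F, Maximal (c · ≠ 0) A) :
    #F ≤ 2 * d ^ 2 := by
  choose y hyA hy using fun A : F => exists_ne_zero_of_maximal_coeff (htop A A.2) x
  have hdisj : ∀ i (A B : F), y A i ≠ x i → y B i ≠ x i → A = B := fun i A B hA hB =>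
    Subtype.ext (hF.elim_finset A.2 B.2 i (hyA A i hA) (hyA B i hB))
  simpa using card_le_two_mul_sq_of_isMax hdisj hs hmax hx fun A => hsign _ (hy A)

theorem exists_degree_lowering_set {ι : Type*} [DecidableEq ι] [Finite ι] {d a : ℕ}
    {s r : (ι → Bool) → ℝ} (hs : s ∈ cubeDegreeLE ι d) (hr : r ∈ cubeDegreeLE ι (a + 1))
    {x : ι → Bool} (hmax : ∀ z, |s z| ≤ |s x|) (hx : s x ≠ 0)
    (hsign : ∀ z, r z ≠ 0 → s x * s z ≤ 0) :
    ∃ Q : Finset ι, #Q ≤ 2 * d ^ 2 * (a + 1) ∧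
      ∀ ρ, (fun z => r (Q.piecewise ρ z)) ∈ cubeDegreeLE ι a := by
  have := Fintype.ofFinite ι
  obtain ⟨c, hc, rfl⟩ := exists_coeff_of_mem_cubeDegreeLE hr
  obtain ⟨F, hFtop, hFdisj, hFmeets⟩ :=
    exists_pairwiseDisjoint_subset_forall_not_disjoint {B | #B = a + 1 ∧ c B ≠ 0}
  have htop : ∀ A ∈ F, #A = a + 1 ∧ c A ≠ 0 := fun A hA => by simpa using hFtop hA
  have hmaximal : ∀ A ∈ F, Maximal (c · ≠ 0) A := fun A hA =>
    ⟨(htop A hA).2, fun B hB hAB => (eq_of_subset_of_card_le hAB ((hc B hB).trans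
      (htop A hA).1.ge)).ge⟩
  refine ⟨F.biUnion id, ?_, sum_comp_piecewise_mem_cubeDegreeLE fun B hB => ?_⟩
  · exact (card_biUnion_le_card_mul F id (a + 1) fun A hA => (htop A hA).1.le).trans <|
      Nat.mul_le_mul_right _ (card_le_of_pairwiseDisjoint_top_monomials hs hmax hx hsign hFdisj
        hmaximal)
  · rcases (hc B hB).lt_or_eq with hlt | heq
    · exact (card_le_card sdiff_subset).trans (Nat.lt_succ_iff.mp hlt)
    · have hmeets := hFmeets B (by simp [heq, hB]) (card_pos.mp (by omega))
      have hss : B \ F.biUnion id ⊂ B :=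
        sdiff_subset.ssubset_of_ne fun h => hmeets (sdiff_eq_left.mp h)
      have := card_lt_card hss
      omega

/-! ### Decision trees -/

section DecisionTrees

variable {n : ℕ} {f : (Fin n → Bool) → Bool}

theorem D_le_depth {T : DecisionTree n} (hT : T.Computes f) : D f ≤ T.depth :=
  Nat.sInf_le ⟨T, hT, rfl⟩

theorem D_eq_zero_of_forall_eq (h : ∀ x y, f x = f y) : D f = 0 :=
  Nat.le_zero.mp (D_le_depth (T := .leaf (f fun _ => false)) fun _ => h _ _)

theorem D_le_of_update {m : ℕ} (i : Fin n)
    (h : ∀ b, D (fun x => f (Function.update x i b)) ≤ m) : D f ≤ m + 1 := by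
  choose T hT hdepth using fun b => exists_D fun x => f (Function.update x i b)
  have hquery : (DecisionTree.query i (T false) (T true)).Computes f := by
    intro x
    have hi : (T (x i)).output x = f x := by
      simpa only [Function.update_eq_self] using hT (x i) x
    cases hx : x i <;> simpa [DecisionTree.output, hx] using hi
  calc D f ≤ max (T false).depth (T true).depth + 1 := D_le_depth hquery
    _ ≤ m + 1 := Nat.succ_le_succ (max_le ((hdepth _).trans_le (h _)) ((hdepth _).trans_le (h _)))

theorem D_le_card_add {m : ℕ} (Q : Finset (Fin n)) (f : (Fin n → Bool) → Bool)
    (h : ∀ ρ, D (fun x => f (Q.piecewise ρ x)) ≤ m) : D f ≤ #Q + m := by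
  induction Q using Finset.induction_on generalizing f with
  | empty => simpa using h fun _ => false
  | insert i Q hi ih =>
    rw [card_insert_of_notMem hi, add_right_comm]
    refine D_le_of_update i fun b => ih _ fun ρ => ?_
    have hpiecewise : ∀ x, Function.update (Q.piecewise ρ x) i b
        = (insert i Q).piecewise (Function.update ρ i b) x := by
      intro x
      rw [piecewise_insert, Function.update_self]
      congr 1
      exact Q.piecewise_congr (fun j hj => by
        rw [Function.update_of_ne (ne_of_mem_of_not_mem hj hi)]) fun _ _ => rfl
    simpa only [hpiecewise] using h (Function.update ρ i b)

end DecisionTrees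

/-! ### Nondeterministic representations -/

section Nondeterministic

variable {n : ℕ} {f : (Fin n → Bool) → Bool}

/-- `r` is nonzero exactly at the points where `f` takes the value `b`. For `b = true` this is a
nondeterministic representation of `f`, for `b = false` one of its negation. -/
def IsNondetRep (f : (Fin n → Bool) → Bool) (b : Bool) (r : (Fin n → Bool) → ℝ) : Prop :=
  ∀ x, r x ≠ 0 ↔ f x = b

theorem IsNondetRep.apply_eq_apply {b : Bool} {r : (Fin n → Bool) → ℝ} (hr : IsNondetRep f b r)
    (hdeg : r ∈ cubeDegreeLE (Fin n) 0) (x y : Fin n → Bool) : f x = f y := by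
  have h : f x = b ↔ f y = b := by rw [← hr x, ← hr y, eq_of_mem_cubeDegreeLE_zero hdeg x y]
  cases hx : f x <;> cases hy : f y <;> cases b <;> simp_all

theorem IsSignRep.mul_neg {p : MvPolynomial (Fin n) ℝ} (hp : IsSignRep f p) {x z : Fin n → Bool}
    (h : f x ≠ f z) : evalAt p x * evalAt p z < 0 := by
  have hpos : ∀ w, f w = false → 0 < evalAt p w := fun w hw =>
    (hp.2 w).1.lt_or_gt.resolve_left fun hlt => by simp [(hp.2 w).2.mp hlt] at hw
  cases hx : f x <;> cases hz : f z
  · simp [hx, hz] at h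
  · exact mul_neg_of_pos_of_neg (hpos x hx) ((hp.2 z).2.mpr hz)
  · exact mul_neg_of_neg_of_pos ((hp.2 x).2.mpr hx) (hpos z hz)
  · simp [hx, hz] at h

theorem IsRationalRep.exists_isNondetRep {p q : MvPolynomial (Fin n) ℝ} (h : IsRationalRep f p q)
    (b : Bool) : ∃ r ∈ cubeDegreeLE (Fin n) (max p.totalDegree q.totalDegree),
      IsNondetRep f b r := by
  have hp : evalAt p ∈ cubeDegreeLE (Fin n) (max p.totalDegree q.totalDegree) :=
    cubeDegreeLE_mono (le_max_left _ _) (evalAt_mem_cubeDegreeLE p)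
  have hq : evalAt q ∈ cubeDegreeLE (Fin n) (max p.totalDegree q.totalDegree) :=
    cubeDegreeLE_mono (le_max_right _ _) (evalAt_mem_cubeDegreeLE q)
  have hpq : ∀ x, evalAt p x = bit (f x) * evalAt q x := fun x =>
    (div_eq_iff (h.2.2 x).1).mp (h.2.2 x).2
  cases b
  · refine ⟨evalAt q - evalAt p, Submodule.sub_mem _ hq hp, fun x => ?_⟩
    cases hf : f x <;> simp [hpq, hf, bit, (h.2.2 x).1]
  · refine ⟨evalAt p, hp, fun x => ?_⟩
    cases hf : f x <;> simp [hpq, hf, bit, (h.2.2 x).1]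

/-- A round with `r b` of degree `a b` makes at most `2 * d ^ 2 * a b` queries and lowers `a b` by
one; the bound is the sum of these costs down to degree zero. -/
theorem D_le_of_isNondetRep {d : ℕ} {s : (Fin n → Bool) → ℝ}
    (hs : s ∈ cubeDegreeLE (Fin n) d) (hs0 : ∀ x, s x ≠ 0)
    (hsign : ∀ x z, f x ≠ f z → s x * s z ≤ 0) {a : Bool → ℕ}
    {r : Bool → (Fin n → Bool) → ℝ} (hr : ∀ b, r b ∈ cubeDegreeLE (Fin n) (a b))
    (hf : ∀ b, IsNondetRep f b (r b)) : D f ≤ d ^ 2 * ∑ b, a b * (a b + 1) := by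
  induction a using WellFoundedLT.induction generalizing f s r with
  | ind a ih =>
    obtain ⟨x, hmax⟩ := Finite.exists_max fun z => |s z|
    set b := !f x with hb
    rcases hab : a b with _ | m
    · rw [D_eq_zero_of_forall_eq ((hf b).apply_eq_apply (hab ▸ hr b))]
      exact Nat.zero_le _
    obtain ⟨Q, hQ, hlower⟩ := exists_degree_lowering_set hs (hab ▸ hr b) hmax (hs0 x) fun z hz =>
      hsign x z (by simp [(hf b z).mp hz, hb])
    have hlt : Function.update a b m < a := update_lt_self_iff.mpr (by omega)
    have hrest : ∀ ρ, D (fun z => f (Q.piecewise ρ z))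
        ≤ d ^ 2 * ∑ c, Function.update a b m c * (Function.update a b m c + 1) := fun ρ => by
      refine ih _ hlt (f := fun z => f (Q.piecewise ρ z))
        (r := fun c z => r c (Q.piecewise ρ z)) (comp_piecewise_mem_cubeDegreeLE hs Q ρ)
        (fun _ => hs0 _) (fun _ _ => hsign _ _) (fun c => ?_) fun c z => hf c (Q.piecewise ρ z)
      rcases eq_or_ne c b with rfl | hc
      · simpa using hlower ρ
      · simpa [hc] using comp_piecewise_mem_cubeDegreeLE (hr c) Q ρ
    calc D f ≤ #Q + d ^ 2 * ∑ c, Function.update a b m c * (Function.update a b m c + 1) :=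
          D_le_card_add Q f hrest
      _ ≤ 2 * d ^ 2 * (m + 1)
          + d ^ 2 * ∑ c, Function.update a b m c * (Function.update a b m c + 1) := by gcongr
      _ = d ^ 2 * ∑ c, a c * (a c + 1) := by
          clear_value b
          cases b <;> simp [hab] <;> ring

end Nondeterministic

end BoolFn

theorem mainTheorem3 (n : ℕ) (f : (Fin n → Bool) → Bool) :
    BoolFn.D f ≤ 4 * BoolFn.sdeg f ^ 2 * BoolFn.rdeg f ^ 2 := by
  obtain ⟨s, hs, hsdeg⟩ := BoolFn.exists_sdeg f
  obtain ⟨p, q, hpq, hrdeg⟩ := BoolFn.exists_rdeg f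
  choose r hr hf using hpq.exists_isNondetRep
  rw [← hsdeg, ← hrdeg]
  set d := s.totalDegree
  set e := max p.totalDegree q.totalDegree
  calc BoolFn.D f
      ≤ d ^ 2 * ∑ _b : Bool, e * (e + 1) :=
        BoolFn.D_le_of_isNondetRep (BoolFn.evalAt_mem_cubeDegreeLE s) (fun x => (hs.2 x).1)
          (fun _ _ h => (hs.mul_neg h).le) hr hf
    _ = 2 * d ^ 2 * (e ^ 2 + e) := by
        rw [Fintype.sum_bool]
        ring
    _ ≤ 2 * d ^ 2 * (e ^ 2 + e ^ 2) := by
        gcongr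
        exact Nat.le_self_pow two_ne_zero e
    _ = 4 * d ^ 2 * e ^ 2 := by ring
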